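/- Let $\Omega\subset\{(r,z)\in\mathbb R^2: r>0\}$ be a bounded open set (for instance a bounded Lipschitz domain). Let $L^2_r(\Omega)$ be the space of real functions $u$ on $\Omega$ with $\|u\|^2_{L^2_r}=\int_\Omega u^2\,r\,dr\,dz<\infty$, with inner product $(u,v)_{L^2_r}=\int_\Omega uv\,r\,dr\,dz$, and give $\boldsymbol L^2_r(\Omega)=L^2_r(\Omega)^3$ the corresponding inner product. For an integer $n>0$ define, in the sense of distributions on $\Omega$, $$d^0u=\Big(\partial_ru,\,-\tfrac nr u,\,\partial_zu\Big),$$ $$d^1(u_r,u_\theta,u_z)=\Big(-\big(\tfrac nr u_z+\partial_zu_\theta\big),\ \partial_zu_r-\partial_ru_z,\ \tfrac{nu_r+u_\theta}{r}+\partial_ru_\theta\Big),$$ $$d^2(u_r,u_\theta,u_z)=\partial_ru_r+\tfrac{u_r-nu_\theta}{r}+\partial_zu_z ,\qquad d^3=0 .$$ Let $W^0=W^3=L^2_r(\Omega)$ and $W^1=W^2=\boldsymbol L^2_r(\Omega)$. For $k=0,1,2$ let $V^k=\{v\in W^k: d^kv\in W^{k+1}\}$, let $V^3=W^3$ and $V^{-1}=0$,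 and put $\|v\|_{V^k}^2=\|v\|^2_{L^2_r}+\|d^kv\|^2_{L^2_r}$. Then there is a constant $C>0$ depending only on $\Omega$ such that for every integer $n>0$, every $k\in\{0,1,2,3\}$ and every $f\in W^k$, there is exactly one pair $(\sigma,u)\in V^{k-1}\times V^k$ with $$\begin{aligned}(\sigma,\tau)_{L^2_r}-(d^{k-1}\tau,u)_{L^2_r}&=0&&\text{for all }\tau\in V^{k-1},\\ (d^{k-1}\sigma,v)_{L^2_r}+(d^ku,d^kv)_{L^2_r}&=(f,v)_{L^2_r}&&\text{for all }v\in V^k,\end{aligned}$$ and this pair satisfies $$\|u\|_{V^k}+\|\sigma\|_{V^{k-1}}\le C\,\|f\|_{L^2_r}.$$ -/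

import Mathlib

open MeasureTheory Set
open scoped ContDiff ENNReal InnerProductSpace

/-! # Weighted Hodge complex of a Fourier mode on a meridian domain

A point `x : ℝ × ℝ` of the meridian half plane has coordinates `r = x.1`, `z = x.2`. -/

/-- A bounded open subset of the open half plane `{(r, z) : r > 0}`. -/
structure MeridianDomain where
  carrier : Set (ℝ × ℝ)
  isOpen : IsOpen carrier
  isBounded : Bornology.IsBounded carrier
  pos : ∀ x ∈ carrier, 0 < x.1

namespace MeridianDomain

/-- The measure `r dr dz` on the domain. -/
noncomputable def measure (Ω : MeridianDomain) : Measure (ℝ × ℝ) :=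
  (volume.restrict Ω.carrier).withDensity fun x => ENNReal.ofReal x.1

/-- The weighted space `L²_r(Ω)` of real functions. -/
abbrev L2 (Ω : MeridianDomain) : Type := Lp ℝ 2 Ω.measure

/-- The space `L²_r(Ω)³` of vector fields; the components `0, 1, 2` are the
`r`-, `θ`- and `z`-components. -/
abbrev L2Vec (Ω : MeridianDomain) : Type := Lp (EuclideanSpace ℝ (Fin 3)) 2 Ω.measure

/-- Test functions: smooth functions with compact support inside `Ω`. -/
def IsTest (Ω : MeridianDomain) (φ : ℝ × ℝ → ℝ) : Prop :=
  ContDiff ℝ ∞ φ ∧ HasCompactSupport φ ∧ tsupport φ ⊆ Ω.carrier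

/-- The (unweighted) distributional pairing `∫_Ω v ψ dr dz`. -/
noncomputable def pair (Ω : MeridianDomain) (v ψ : ℝ × ℝ → ℝ) : ℝ :=
  ∫ x in Ω.carrier, v x * ψ x

end MeridianDomain

/-- The partial derivative `∂φ/∂r`. -/
noncomputable def partialR (φ : ℝ × ℝ → ℝ) (x : ℝ × ℝ) : ℝ := fderiv ℝ φ x (1, 0)

/-- The partial derivative `∂φ/∂z`. -/
noncomputable def partialZ (φ : ℝ × ℝ → ℝ) (x : ℝ × ℝ) : ℝ := fderiv ℝ φ x (0, 1)

/-- The function `φ / r`. -/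
noncomputable def divR (φ : ℝ × ℝ → ℝ) (x : ℝ × ℝ) : ℝ := φ x / x.1

namespace MeridianDomain

variable (Ω : MeridianDomain) (n : ℕ)

/-- `g = (∂_r u, -(n/r) u, ∂_z u)` in the sense of distributions on `Ω`. -/
def HasGrad (u : Ω.L2) (g : Ω.L2Vec) : Prop :=
  ∀ φ, Ω.IsTest φ →
    Ω.pair (fun x => g x 0) φ = -Ω.pair u (partialR φ) ∧
    Ω.pair (fun x => g x 1) φ = -(n * Ω.pair u (divR φ)) ∧
    Ω.pair (fun x => g x 2) φ = -Ω.pair u (partialZ φ)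

/-- `g = (-((n/r) u_z + ∂_z u_θ), ∂_z u_r - ∂_r u_z, (n u_r + u_θ)/r + ∂_r u_θ)` in the sense of
distributions on `Ω`. -/
def HasCurl (u g : Ω.L2Vec) : Prop :=
  ∀ φ, Ω.IsTest φ →
    Ω.pair (fun x => g x 0) φ
      = -(n * Ω.pair (fun x => u x 2) (divR φ) - Ω.pair (fun x => u x 1) (partialZ φ)) ∧
    Ω.pair (fun x => g x 1) φ
      = -Ω.pair (fun x => u x 0) (partialZ φ) + Ω.pair (fun x => u x 2) (partialR φ) ∧
    Ω.pair (fun x => g x 2) φ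
      = n * Ω.pair (fun x => u x 0) (divR φ) + Ω.pair (fun x => u x 1) (divR φ)
        - Ω.pair (fun x => u x 1) (partialR φ)

/-- `g = ∂_r u_r + (u_r - n u_θ)/r + ∂_z u_z` in the sense of distributions on `Ω`. -/
def HasDiv (u : Ω.L2Vec) (g : Ω.L2) : Prop :=
  ∀ φ, Ω.IsTest φ →
    Ω.pair g φ
      = -Ω.pair (fun x => u x 0) (partialR φ)
        + (Ω.pair (fun x => u x 0) (divR φ) - n * Ω.pair (fun x => u x 1) (divR φ))
        - Ω.pair (fun x => u x 2) (partialZ φ)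

/-! ### The distributional operators are linear and single valued -/

variable {Ω n}

theorem measurableSet_carrier : MeasurableSet Ω.carrier := Ω.isOpen.measurableSet

theorem ae_restrict_of_ae {p : ℝ × ℝ → Prop} (h : ∀ᵐ x ∂Ω.measure, p x) :
    ∀ᵐ x ∂(volume.restrict Ω.carrier), p x := by
  rw [measure, ae_withDensity_iff (by fun_prop)] at h
  filter_upwards [h, ae_restrict_mem measurableSet_carrier] with x hx hm
  exact hx (by simpa using Ω.pos x hm)

theorem ae_of_ae_restrict {p : ℝ × ℝ → Prop} (h : ∀ᵐ x ∂(volume.restrict Ω.carrier), p x) :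
    ∀ᵐ x ∂Ω.measure, p x :=
  (withDensity_absolutelyContinuous _ _).ae_le h

theorem integrableOn_compact {f : ℝ × ℝ → ℝ} (hf : MemLp f 2 Ω.measure) {K : Set (ℝ × ℝ)}
    (hK : IsCompact K) (hKΩ : K ⊆ Ω.carrier) : IntegrableOn f K := by
  obtain ⟨C, hC⟩ := hK.exists_bound_of_continuousOn (f := fun x : ℝ × ℝ => (x.1)⁻¹)
    (continuousOn_fst.inv₀ fun x hx => (Ω.pos x (hKΩ hx)).ne')
  have hle : (volume.restrict K) ≤ ENNReal.ofReal C • Ω.measure := by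
    refine Measure.le_iff.2 fun s hs => ?_
    rw [Measure.restrict_apply hs, Measure.smul_apply, smul_eq_mul, measure,
      withDensity_apply _ hs, ← lintegral_const_mul _ (by fun_prop), Measure.restrict_restrict hs]
    calc volume (s ∩ K) = ∫⁻ _ in s ∩ K, 1 := by simp
      _ ≤ ∫⁻ x in s ∩ K, ENNReal.ofReal C * ENNReal.ofReal x.1 := by
          refine setLIntegral_mono' (hs.inter hK.measurableSet) fun x hx => ?_
          have hp := Ω.pos x (hKΩ hx.2)
          have hb := hC x hx.2
          rw [Real.norm_of_nonneg (inv_nonneg.2 hp.le)] at hb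
          have hC0 : 0 ≤ C := (inv_nonneg.2 hp.le).trans hb
          rw [← ENNReal.ofReal_mul hC0, ← ENNReal.ofReal_one]
          refine ENNReal.ofReal_le_ofReal ?_
          calc (1 : ℝ) = x.1⁻¹ * x.1 := (inv_mul_cancel₀ hp.ne').symm
            _ ≤ C * x.1 := mul_le_mul_of_nonneg_right hb hp.le
      _ ≤ ∫⁻ x in s ∩ Ω.carrier, ENNReal.ofReal C * ENNReal.ofReal x.1 :=
          lintegral_mono_set (inter_subset_inter_right _ hKΩ)
  have : IsFiniteMeasure (volume.restrict K) := isFiniteMeasure_restrict.2 hK.measure_lt_top.ne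
  exact (hf.of_measure_le_smul ENNReal.ofReal_ne_top hle).integrable (by norm_num)

/-- Functions which may be paired with every element of `L²_r(Ω)`. -/
def Pairable (Ω : MeridianDomain) (ψ : ℝ × ℝ → ℝ) : Prop :=
  ∃ K, IsCompact K ∧ K ⊆ Ω.carrier ∧ ContinuousOn ψ K ∧ ∀ x ∉ K, ψ x = 0

theorem Pairable.integrableOn {ψ : ℝ × ℝ → ℝ} (hψ : Ω.Pairable ψ) {f : ℝ × ℝ → ℝ}
    (hf : MemLp f 2 Ω.measure) : IntegrableOn (fun x => f x * ψ x) Ω.carrier := by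
  obtain ⟨K, hK, hKΩ, hc, h0⟩ := hψ
  refine ((integrableOn_compact hf hK hKΩ).mul_continuousOn hc hK).of_forall_sdiff_eq_zero
    measurableSet_carrier fun x hx => ?_
  simp [h0 x hx.2]

theorem IsTest.pairable {φ : ℝ × ℝ → ℝ} (h : Ω.IsTest φ) : Ω.Pairable φ :=
  ⟨tsupport φ, h.2.1, h.2.2, h.1.continuous.continuousOn,
    fun _ hx => image_eq_zero_of_notMem_tsupport hx⟩

theorem IsTest.pairable_divR {φ : ℝ × ℝ → ℝ} (h : Ω.IsTest φ) : Ω.Pairable (divR φ) :=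
  ⟨tsupport φ, h.2.1, h.2.2,
    h.1.continuous.continuousOn.div continuousOn_fst fun x hx => (Ω.pos x (h.2.2 hx)).ne',
    fun _ hx => by simp [divR, image_eq_zero_of_notMem_tsupport hx]⟩

theorem IsTest.pairable_fderiv {φ : ℝ × ℝ → ℝ} (h : Ω.IsTest φ) (e : ℝ × ℝ) :
    Ω.Pairable fun x => fderiv ℝ φ x e :=
  ⟨tsupport φ, h.2.1, h.2.2,
    ((h.1.continuous_fderiv (by simp)).clm_apply continuous_const).continuousOn,
    fun x hx => by
      change fderiv ℝ φ x e = 0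
      rw [image_eq_zero_of_notMem_tsupport fun h' => hx (tsupport_fderiv_subset ℝ h')]; rfl⟩

theorem IsTest.pairable_partialR {φ : ℝ × ℝ → ℝ} (h : Ω.IsTest φ) : Ω.Pairable (partialR φ) :=
  h.pairable_fderiv _

theorem IsTest.pairable_partialZ {φ : ℝ × ℝ → ℝ} (h : Ω.IsTest φ) : Ω.Pairable (partialZ φ) :=
  h.pairable_fderiv _

theorem pair_congr {f g : ℝ × ℝ → ℝ} (h : f =ᵐ[Ω.measure] g) (ψ : ℝ × ℝ → ℝ) :
    Ω.pair f ψ = Ω.pair g ψ :=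
  integral_congr_ae <| (ae_restrict_of_ae h).mono fun x hx => by simp only [hx]

theorem pair_add {ψ f g : ℝ × ℝ → ℝ} (hψ : Ω.Pairable ψ) (hf : MemLp f 2 Ω.measure)
    (hg : MemLp g 2 Ω.measure) : Ω.pair (fun x => f x + g x) ψ = Ω.pair f ψ + Ω.pair g ψ := by
  rw [pair, pair, pair, ← integral_add (hψ.integrableOn hf) (hψ.integrableOn hg)]
  simp only [add_mul]

theorem pair_smul (c : ℝ) (ψ f : ℝ × ℝ → ℝ) :
    Ω.pair (fun x => c * f x) ψ = c * Ω.pair f ψ := by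
  simp only [pair, mul_assoc, integral_const_mul]

theorem memLp_comp (u : Ω.L2Vec) (i : Fin 3) : MemLp (fun x => u x i) 2 Ω.measure :=
  memLp_piLp_iff.1 (Lp.memLp u) i

theorem pair_coe_add {ψ : ℝ × ℝ → ℝ} (hψ : Ω.Pairable ψ) (u v : Ω.L2) :
    Ω.pair (u + v : Ω.L2) ψ = Ω.pair u ψ + Ω.pair v ψ := by
  rw [← pair_add hψ (Lp.memLp u) (Lp.memLp v)]
  exact pair_congr (Lp.coeFn_add u v) ψ

theorem pair_coe_smul (ψ : ℝ × ℝ → ℝ) (c : ℝ) (u : Ω.L2) :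
    Ω.pair (c • u : Ω.L2) ψ = c * Ω.pair u ψ := by
  rw [← pair_smul]
  exact pair_congr (Lp.coeFn_smul c u) ψ

theorem pair_coe_zero (ψ : ℝ × ℝ → ℝ) : Ω.pair (0 : Ω.L2) ψ = 0 := by
  simpa using pair_coe_smul ψ 0 (0 : Ω.L2)

theorem pair_comp_add {ψ : ℝ × ℝ → ℝ} (hψ : Ω.Pairable ψ) (u v : Ω.L2Vec) (i : Fin 3) :
    Ω.pair (fun x => (u + v : Ω.L2Vec) x i) ψ
      = Ω.pair (fun x => u x i) ψ + Ω.pair (fun x => v x i) ψ := by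
  rw [← pair_add hψ (memLp_comp u i) (memLp_comp v i)]
  exact pair_congr ((Lp.coeFn_add u v).mono fun x hx => by simp only [hx]; rfl) ψ

theorem pair_comp_smul (ψ : ℝ × ℝ → ℝ) (c : ℝ) (u : Ω.L2Vec) (i : Fin 3) :
    Ω.pair (fun x => (c • u : Ω.L2Vec) x i) ψ = c * Ω.pair (fun x => u x i) ψ := by
  rw [← pair_smul]
  exact pair_congr ((Lp.coeFn_smul c u).mono fun x hx => by simp only [hx]; rfl) ψ

theorem pair_comp_zero (ψ : ℝ × ℝ → ℝ) (i : Fin 3) :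
    Ω.pair (fun x => (0 : Ω.L2Vec) x i) ψ = 0 := by
  simpa using pair_comp_smul ψ 0 (0 : Ω.L2Vec) i

theorem ae_eq_zero_of_pair {f : ℝ × ℝ → ℝ} (hf : MemLp f 2 Ω.measure)
    (h : ∀ φ, Ω.IsTest φ → Ω.pair f φ = 0) : ∀ᵐ x ∂Ω.measure, f x = 0 := by
  have hloc : LocallyIntegrableOn f Ω.carrier :=
    (locallyIntegrableOn_iff Ω.isOpen.isLocallyClosed).2
      fun K hKΩ hK => integrableOn_compact hf hK hKΩ
  refine ae_of_ae_restrict ((ae_restrict_iff' measurableSet_carrier).2 ?_)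
  refine Ω.isOpen.ae_eq_zero_of_integral_contDiff_smul_eq_zero hloc fun φ h1 h2 h3 => ?_
  have := h φ ⟨h1, h2, h3⟩
  rw [pair, setIntegral_eq_integral_of_forall_compl_eq_zero] at this
  · simpa [mul_comm] using this
  · intro x hx
    simp [image_eq_zero_of_notMem_tsupport fun h' => hx (h3 h')]

theorem eq_zero_of_pair {u : Ω.L2} (h : ∀ φ, Ω.IsTest φ → Ω.pair u φ = 0) : u = 0 :=
  (Lp.eq_zero_iff_ae_eq_zero).2 (ae_eq_zero_of_pair (Lp.memLp u) h)

theorem eq_zero_of_pair_comp {u : Ω.L2Vec}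
    (h : ∀ φ, Ω.IsTest φ → ∀ i, Ω.pair (fun x => u x i) φ = 0) : u = 0 := by
  refine (Lp.eq_zero_iff_ae_eq_zero).2 ?_
  have := ae_all_iff.2 fun i => ae_eq_zero_of_pair (memLp_comp u i) fun φ hφ => h φ hφ i
  filter_upwards [this] with x hx
  ext i
  simpa using hx i

/-! ### The operators as unbounded operators with their maximal domains -/

variable (Ω n)

/-- The graph `{(u, grad u)}`. -/
noncomputable def gradGraph : Submodule ℝ (Ω.L2 × Ω.L2Vec) where
  carrier := {p | Ω.HasGrad n p.1 p.2}
  zero_mem' φ _ := by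
    simp only [Prod.fst_zero, Prod.snd_zero, pair_coe_zero, pair_comp_zero]; simp
  add_mem' {p q} hp hq φ hφ := by
    obtain ⟨a, b, c⟩ := hp φ hφ
    obtain ⟨a', b', c'⟩ := hq φ hφ
    simp only [Prod.fst_add, Prod.snd_add, pair_comp_add hφ.pairable,
      pair_coe_add hφ.pairable_divR, pair_coe_add hφ.pairable_partialR,
      pair_coe_add hφ.pairable_partialZ, a, b, c, a', b', c']
    refine ⟨by ring, by ring, by ring⟩
  smul_mem' t p hp φ hφ := by
    obtain ⟨a, b, c⟩ := hp φ hφ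
    simp only [Prod.smul_fst, Prod.smul_snd, pair_comp_smul, pair_coe_smul, a, b, c]
    refine ⟨by ring, by ring, by ring⟩

/-- The graph `{(u, curl u)}`. -/
noncomputable def curlGraph : Submodule ℝ (Ω.L2Vec × Ω.L2Vec) where
  carrier := {p | Ω.HasCurl n p.1 p.2}
  zero_mem' φ _ := by
    simp only [Prod.fst_zero, Prod.snd_zero, pair_comp_zero]; simp
  add_mem' {p q} hp hq φ hφ := by
    obtain ⟨a, b, c⟩ := hp φ hφ
    obtain ⟨a', b', c'⟩ := hq φ hφ
    simp only [Prod.fst_add, Prod.snd_add, pair_comp_add hφ.pairable,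
      pair_comp_add hφ.pairable_divR, pair_comp_add hφ.pairable_partialR,
      pair_comp_add hφ.pairable_partialZ, a, b, c, a', b', c']
    refine ⟨by ring, by ring, by ring⟩
  smul_mem' t p hp φ hφ := by
    obtain ⟨a, b, c⟩ := hp φ hφ
    simp only [Prod.smul_fst, Prod.smul_snd, pair_comp_smul, a, b, c]
    refine ⟨by ring, by ring, by ring⟩

/-- The graph `{(u, div u)}`. -/
noncomputable def divGraph : Submodule ℝ (Ω.L2Vec × Ω.L2) where
  carrier := {p | Ω.HasDiv n p.1 p.2}
  zero_mem' φ _ := by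
    simp only [Prod.fst_zero, Prod.snd_zero, pair_coe_zero, pair_comp_zero]; simp
  add_mem' {p q} hp hq φ hφ := by
    have a := hp φ hφ
    have a' := hq φ hφ
    simp only [Prod.fst_add, Prod.snd_add, pair_coe_add hφ.pairable,
      pair_comp_add hφ.pairable_divR, pair_comp_add hφ.pairable_partialR,
      pair_comp_add hφ.pairable_partialZ, a, a']
    ring
  smul_mem' t p hp φ hφ := by
    have a := hp φ hφ
    simp only [Prod.smul_fst, Prod.smul_snd, pair_comp_smul, pair_coe_smul, a]
    ring

/-- `d⁰`: the operator `u ↦ (∂_r u, -(n/r) u, ∂_z u)` on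
`H_r(gradⁿ, Ω) = {u ∈ L²_r : gradⁿ u ∈ (L²_r)³}`. -/
noncomputable def gradOp : Ω.L2 →ₗ.[ℝ] Ω.L2Vec := (Ω.gradGraph n).toLinearPMap

/-- `d¹`: the operator
`u ↦ (-((n/r) u_z + ∂_z u_θ), ∂_z u_r - ∂_r u_z, (n u_r + u_θ)/r + ∂_r u_θ)` on
`H_r(curlⁿ, Ω) = {u ∈ (L²_r)³ : curlⁿ u ∈ (L²_r)³}`. -/
noncomputable def curlOp : Ω.L2Vec →ₗ.[ℝ] Ω.L2Vec := (Ω.curlGraph n).toLinearPMap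

/-- `d²`: the operator `u ↦ ∂_r u_r + (u_r - n u_θ)/r + ∂_z u_z` on
`H_r(divⁿ, Ω) = {u ∈ (L²_r)³ : divⁿ u ∈ L²_r}`. -/
noncomputable def divOp : Ω.L2Vec →ₗ.[ℝ] Ω.L2 := (Ω.divGraph n).toLinearPMap

/-- The zero space, which is put at both ends of the complex. -/
abbrev ZeroSpace : Type := EuclideanSpace ℝ (Fin 0)

/-- `d⁻¹ : 0 → L²_r(Ω)`. -/
noncomputable def initOp : ZeroSpace →ₗ.[ℝ] Ω.L2 := 0

/-- `d³ = 0 : L²_r(Ω) → 0`, defined on all of `L²_r(Ω)`. -/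
noncomputable def lastOp : Ω.L2 →ₗ.[ℝ] ZeroSpace := 0

variable {Ω n}

/-- `gradOp` is the distributional operator: `u` is in the domain and is mapped to `g` if and only
if `g = gradⁿ u` in the sense of distributions. -/
theorem mem_graph_gradOp {u : Ω.L2} {g : Ω.L2Vec} :
    (u, g) ∈ (Ω.gradOp n).graph ↔ Ω.HasGrad n u g := by
  rw [gradOp, Submodule.toLinearPMap_graph_eq]
  · rfl
  · rintro ⟨u, g⟩ h (rfl : u = 0)
    refine eq_zero_of_pair_comp fun φ hφ i => ?_
    obtain ⟨a, b, c⟩ := h φ hφ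
    simp only [pair_coe_zero] at a b c
    fin_cases i <;> simp_all

theorem mem_graph_curlOp {u g : Ω.L2Vec} :
    (u, g) ∈ (Ω.curlOp n).graph ↔ Ω.HasCurl n u g := by
  rw [curlOp, Submodule.toLinearPMap_graph_eq]
  · rfl
  · rintro ⟨u, g⟩ h (rfl : u = 0)
    refine eq_zero_of_pair_comp fun φ hφ i => ?_
    obtain ⟨a, b, c⟩ := h φ hφ
    simp only [pair_comp_zero] at a b c
    fin_cases i <;> simp_all

theorem mem_graph_divOp {u : Ω.L2Vec} {g : Ω.L2} :
    (u, g) ∈ (Ω.divOp n).graph ↔ Ω.HasDiv n u g := by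
  rw [divOp, Submodule.toLinearPMap_graph_eq]
  · rfl
  · rintro ⟨u, g⟩ h (rfl : u = 0)
    refine eq_zero_of_pair fun φ hφ => ?_
    have a := h φ hφ
    simp only [pair_comp_zero] at a
    simp_all

end MeridianDomain

/-! ### The mixed formulation -/

section Mixed

variable {E F G : Type*} [NormedAddCommGroup E] [InnerProductSpace ℝ E]
  [NormedAddCommGroup F] [InnerProductSpace ℝ F] [NormedAddCommGroup G] [InnerProductSpace ℝ G]

/-- The graph norm `‖v‖_V = (‖v‖² + ‖d v‖²)^{1/2}` on the domain of an unbounded operator `d`. -/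
noncomputable def graphNorm (d : E →ₗ.[ℝ] F) (v : d.domain) : ℝ :=
  √(‖(v : E)‖ ^ 2 + ‖d v‖ ^ 2)

/-- `(σ, u) ∈ V^{k-1} × V^k` solves the mixed formulation of the Hodge Laplacian with datum `f`,
where `d' = d^{k-1} : V^{k-1} → W^k` and `d = d^k : V^k → W^{k+1}`. -/
def IsMixedSolution (d' : E →ₗ.[ℝ] F) (d : F →ₗ.[ℝ] G) (f : F)
    (σ : d'.domain) (u : d.domain) : Prop :=
  (∀ τ : d'.domain, ⟪(σ : E), (τ : E)⟫_ℝ - ⟪d' τ, (u : F)⟫_ℝ = 0) ∧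
  (∀ v : d.domain, ⟪d' σ, (v : F)⟫_ℝ + ⟪d u, d v⟫_ℝ = ⟪f, (v : F)⟫_ℝ)

/-- The mixed formulation is well-posed with stability constant `C`: for every `f ∈ W^k` there is
exactly one solution `(σ, u)`, and `‖u‖_{V^k} + ‖σ‖_{V^{k-1}} ≤ C ‖f‖`. -/
def MixedWellPosed (d' : E →ₗ.[ℝ] F) (d : F →ₗ.[ℝ] G) (C : ℝ) : Prop :=
  ∀ f : F,
    (∃! p : d'.domain × d.domain, IsMixedSolution d' d f p.1 p.2) ∧
    ∀ (σ : d'.domain) (u : d.domain), IsMixedSolution d' d f σ u →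
      graphNorm d u + graphNorm d' σ ≤ C * ‖f‖

end Mixed

/-!
In three dimensions the operators `d⁰, d¹, d²` are the gradient, curl and divergence acting on
fields whose dependence on the angle `θ` is a fixed Fourier mode of order `n`. On such fields the Lie
derivative along the rotation field `X = ∂_θ` is, up to a quarter turn, multiplication by `n`, so
Cartan's formula `L_X = d ι_X + ι_X d` says that `ι_X / n` is a contracting homotopy of the complex.
In coordinates

* `h¹ u = -(r/n) u_θ`,
* `h² w = (r/n) (w_z, 0, -w_r)`,
* `h³ w = (0, -(r/n) w, 0)`,

and `h¹ d⁰ = 1`, `d⁰ h¹ + h² d¹ = 1`, `d¹ h² + h³ d² = 1`, `d² h³ = 1` on the maximal domains. These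
operators involve no derivatives, only multiplication by `r`. Since `Ω` is bounded they are bounded
on `L²_r`, uniformly in `n ≥ 1`, and no regularity of the boundary is needed.

The rest is Hilbert space theory. `ContractsAt` records that a pair of operators `d', d` with
`d d' = 0` admits such a homotopy at the middle space. The homotopy gives `ker d = range d'`, shows
that the ranges of `d'` and `d` are closed, and provides the Poincaré inequalities with the norm of
the homotopy as constant. `ContractsAt.graphNorm_add_graphNorm_le` is the stability estimate, which
also gives uniqueness, and `ContractsAt.exists_isMixedSolution` constructs the solution from
orthogonal projections and the adjoints of the homotopy; it needs the graphs to be closed, which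
holds for distributional operators.
-/

/-! ### Well-posedness of the mixed problem for a contractible pair of operators -/

section Contractible

variable {E F G : Type*} [NormedAddCommGroup E] [InnerProductSpace ℝ E]
  [NormedAddCommGroup F] [InnerProductSpace ℝ F] [NormedAddCommGroup G] [InnerProductSpace ℝ G]

/-- The bounded operators `h : F → E` and `h' : G → F` contract the complex `E → F → G` of unbounded
operators `d'`, `d` at its middle term: `d ∘ d' = 0`, and for every `u` in the domain of `d` the
vector `h u` lies in the domain of `d'`, with `d' (h u) + h' (d u) = u`. -/
structure ContractsAt (d' : E →ₗ.[ℝ] F) (d : F →ₗ.[ℝ] G) (h : F →L[ℝ] E) (h' : G →L[ℝ] F) :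
    Prop where
  comp_eq_zero : ∀ x y, (x, y) ∈ d'.graph → (y, 0) ∈ d.graph
  homotopy : ∀ u g, (u, g) ∈ d.graph → (h u, u - h' g) ∈ d'.graph

namespace ContractsAt

variable {d' : E →ₗ.[ℝ] F} {d : F →ₗ.[ℝ] G} {h : F →L[ℝ] E} {h' : G →L[ℝ] F}

theorem exists_apply_eq_zero (H : ContractsAt d' d h h') (σ : d'.domain) :
    ∃ w : d.domain, (w : F) = d' σ ∧ d w = 0 :=
  (LinearPMap.mem_graph_iff d).1 (H.comp_eq_zero _ _ (d'.mem_graph σ))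

theorem exists_homotopy (H : ContractsAt d' d h h') (u : d.domain) :
    ∃ ρ : d'.domain, (ρ : E) = h u ∧ d' ρ = u - h' (d u) :=
  (LinearPMap.mem_graph_iff d').1 (H.homotopy _ _ (d.mem_graph u))

theorem le_of_sq_le_mul {x c : ℝ} (hx : 0 ≤ x) (hc : 0 ≤ c) (h : x ^ 2 ≤ x * c) : x ≤ c := by
  rcases hx.eq_or_lt with rfl | hx
  · exact hc
  · exact le_of_mul_le_mul_left (by rwa [← sq]) hx

theorem graphNorm_le (d : E →ₗ.[ℝ] F) (v : d.domain) : graphNorm d v ≤ ‖(v : E)‖ + ‖d v‖ :=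
  Real.sqrt_le_iff.2 ⟨by positivity, by nlinarith [norm_nonneg (v : E), norm_nonneg (d v)]⟩

theorem norm_le_graphNorm (d : E →ₗ.[ℝ] F) (v : d.domain) : ‖(v : E)‖ ≤ graphNorm d v :=
  Real.le_sqrt_of_sq_le (le_add_of_nonneg_right (sq_nonneg _))

/-- The a priori estimate. The four quantities are bounded in the order `d' σ`, `σ`, `d u`, `u`,
by testing with vectors that `d ∘ d' = 0` and the homotopy provide. -/
theorem graphNorm_add_graphNorm_le (H : ContractsAt d' d h h') {R : ℝ} (hR : ‖h‖ ≤ R)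
    (hR' : ‖h'‖ ≤ R) {f : F} {σ : d'.domain} {u : d.domain} (hs : IsMixedSolution d' d f σ u) :
    graphNorm d u + graphNorm d' σ ≤ (3 * R ^ 2 + 3 * R + 1) * ‖f‖ := by
  obtain ⟨h1, h2⟩ := hs
  have hR0 : 0 ≤ R := (norm_nonneg h).trans hR
  have hle (x : F) : ‖h x‖ ≤ R * ‖x‖ := h.le_of_opNorm_le hR x
  have hle' (x : G) : ‖h' x‖ ≤ R * ‖x‖ := h'.le_of_opNorm_le hR' x
  obtain ⟨w, hw, hdw⟩ := H.exists_apply_eq_zero σ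
  have A : ‖d' σ‖ ≤ ‖f‖ := by
    refine le_of_sq_le_mul (norm_nonneg _) (norm_nonneg _) ?_
    have := h2 w
    rw [hdw, hw, inner_zero_right, add_zero, real_inner_self_eq_norm_sq] at this
    rw [this, mul_comm]
    exact real_inner_le_norm _ _
  have B : ‖(σ : E)‖ ≤ R * ‖f‖ := by
    obtain ⟨ρ, hρ, hdρ⟩ := H.exists_homotopy w
    rw [hdw, map_zero, sub_zero] at hdρ
    have := h1 (σ - ρ)
    rw [d'.map_sub, hdρ, hw, sub_self, inner_zero_left, sub_zero, Submodule.coe_sub,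
      inner_sub_right, real_inner_self_eq_norm_sq, sub_eq_zero] at this
    refine le_of_sq_le_mul (norm_nonneg _) (by positivity) ?_
    rw [this]
    refine (real_inner_le_norm _ _).trans (mul_le_mul_of_nonneg_left ?_ (norm_nonneg _))
    rw [hρ, hw]
    exact (hle _).trans (mul_le_mul_of_nonneg_left A hR0)
  obtain ⟨ρ, hρ, hdρ⟩ := H.exists_homotopy u
  have D : ‖d u‖ ≤ 2 * R * ‖f‖ := by
    obtain ⟨v, hv, hdv⟩ := H.exists_apply_eq_zero ρ
    have e1 := h2 v
    have e2 := h2 u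
    rw [hdv, hv, inner_zero_right, add_zero, hdρ, inner_sub_right, inner_sub_right] at e1
    rw [real_inner_self_eq_norm_sq] at e2
    have e3 : ‖d u‖ ^ 2 = ⟪f - d' σ, h' (d u)⟫_ℝ := by rw [inner_sub_left]; linarith
    refine le_of_sq_le_mul (norm_nonneg _) (by positivity) ?_
    calc ‖d u‖ ^ 2 ≤ ‖f - d' σ‖ * ‖h' (d u)‖ := e3.trans_le (real_inner_le_norm _ _)
      _ ≤ (‖f‖ + ‖f‖) * (R * ‖d u‖) :=
          mul_le_mul ((norm_sub_le _ _).trans (by gcongr)) (hle' _) (norm_nonneg _) (by positivity)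
      _ = ‖d u‖ * (2 * R * ‖f‖) := by ring
  have U : ‖(u : F)‖ ≤ 3 * R ^ 2 * ‖f‖ := by
    have e := h1 ρ
    rw [hρ, hdρ, inner_sub_left, real_inner_self_eq_norm_sq] at e
    have e' : ‖(u : F)‖ ^ 2 = ⟪(σ : E), h u⟫_ℝ + ⟪h' (d u), (u : F)⟫_ℝ := by linarith
    refine le_of_sq_le_mul (norm_nonneg _) (by positivity) ?_
    calc ‖(u : F)‖ ^ 2 ≤ ‖(σ : E)‖ * ‖h u‖ + ‖h' (d u)‖ * ‖(u : F)‖ :=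
          e'.trans_le (add_le_add (real_inner_le_norm _ _) (real_inner_le_norm _ _))
      _ ≤ (R * ‖f‖) * (R * ‖(u : F)‖) + (R * (2 * R * ‖f‖)) * ‖(u : F)‖ := by
          gcongr
          · exact hle _
          · exact (hle' _).trans (by gcongr)
      _ = ‖(u : F)‖ * (3 * R ^ 2 * ‖f‖) := by ring
  have := graphNorm_le d u
  have := graphNorm_le d' σ
  linarith

/-- The kernel of an unbounded operator, as a subspace of the ambient space. -/
def kernel (d : E →ₗ.[ℝ] F) : Submodule ℝ E := d.graph.comap (LinearMap.inl ℝ E F)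

theorem mem_kernel {x : E} : x ∈ kernel d' ↔ (x, 0) ∈ d'.graph := Iff.rfl

theorem isClosed_kernel (hd : IsClosed (d'.graph : Set (E × F))) :
    IsClosed (kernel d' : Set E) :=
  hd.preimage (f := fun x : E => (x, (0 : F))) (by fun_prop)

/-- `h'` is a right inverse of `d` on the range of `d`. -/
theorem apply_mem_graph (H : ContractsAt d' d h h') {u : F} {g : G} (hu : (u, g) ∈ d.graph) :
    (h' g, g) ∈ d.graph := by
  have := d.graph.sub_mem hu (H.comp_eq_zero _ _ (H.homotopy u g hu))
  simpa using this

variable [CompleteSpace E] [CompleteSpace F] [CompleteSpace G]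

/-- Existence. Write `Z = ker d = range d'` and let `P` denote orthogonal projections. Then
`σ` is the part of `h (P_Z f)` orthogonal to `ker d'`, and `u` is the sum of `P_Z (h* σ)` and
of the part orthogonal to `Z` of `h' (P_{range d} (h'* (f - P_Z f)))`. -/
theorem exists_isMixedSolution (H : ContractsAt d' d h h')
    (hd' : IsClosed (d'.graph : Set (E × F))) (hd : IsClosed (d.graph : Set (F × G))) (f : F) :
    ∃ (σ : d'.domain) (u : d.domain), IsMixedSolution d' d f σ u := by
  have : CompleteSpace (kernel d') := (isClosed_kernel hd').completeSpace_coe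
  have : CompleteSpace (kernel d) := (isClosed_kernel hd).completeSpace_coe
  -- The range of `d`: since `h'` inverts `d` there, it consists of the `g` with `d (h' g) = g`,
  -- so it is closed.
  let r : Submodule ℝ G := d.graph.comap (h'.toLinearMap.prod LinearMap.id)
  have hr : IsClosed (r : Set G) :=
    hd.preimage (f := fun g : G => (h' g, g)) (by fun_prop)
  have : CompleteSpace r := hr.completeSpace_coe
  set Z := kernel d
  set N := kernel d'
  -- the part of the datum in the range of `d'`
  set a := Z.starProjection f
  have ha : (a, 0) ∈ d.graph := Z.starProjection_apply_mem f
  have ha' : (h a, a) ∈ d'.graph := by simpa using H.homotopy _ _ ha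
  have hb : f - a ∈ Zᗮ := Z.sub_starProjection_mem_orthogonal f
  set s := h a - N.starProjection (h a)
  have hs : (s, a) ∈ d'.graph := by
    have := d'.graph.sub_mem ha' (N.starProjection_apply_mem (h a) : (_, (0 : F)) ∈ d'.graph)
    simpa using this
  have hsN : s ∈ Nᗮ := N.sub_starProjection_mem_orthogonal (h a)
  -- the two parts of `u`
  set z := Z.starProjection (h.adjoint s)
  have hz : (z, 0) ∈ d.graph := Z.starProjection_apply_mem _
  set g := r.starProjection (h'.adjoint (f - a))
  have hg : (h' g, g) ∈ d.graph := (r.starProjection_apply_mem _ : _)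
  set y := h' g - Z.starProjection (h' g)
  have hy : (y, g) ∈ d.graph := by
    have := d.graph.sub_mem hg (Z.starProjection_apply_mem (h' g) : (_, (0 : G)) ∈ d.graph)
    simpa using this
  have hyZ : y ∈ Zᗮ := Z.sub_starProjection_mem_orthogonal _
  have hu : (z + y, g) ∈ d.graph := by simpa using d.graph.add_mem hz hy
  obtain ⟨σ, hσ, hdσ⟩ := (LinearPMap.mem_graph_iff d').1 hs
  obtain ⟨u, hu, hdu⟩ := (LinearPMap.mem_graph_iff d).1 hu
  refine ⟨σ, u, fun τ => ?_, fun v => ?_⟩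
  · have hτ : (d' τ, 0) ∈ d.graph := H.comp_eq_zero _ _ (d'.mem_graph τ)
    have e1 : ⟪d' τ, y⟫_ℝ = 0 := hyZ _ hτ
    have e2 : ⟪d' τ, z⟫_ℝ = ⟪h (d' τ), s⟫_ℝ := by
      rw [← ContinuousLinearMap.adjoint_inner_right, ← sub_eq_zero, ← inner_sub_right,
        ← neg_sub, inner_neg_right, neg_eq_zero]
      exact Z.sub_starProjection_mem_orthogonal _ _ hτ
    have e3 : ⟪(τ : E) - h (d' τ), s⟫_ℝ = 0 := by
      refine hsN _ ?_
      have := d'.graph.sub_mem (d'.mem_graph τ) (H.homotopy _ _ hτ)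
      simpa [N, mem_kernel] using this
    rw [hσ, hu, inner_add_right, e1, e2, real_inner_comm, add_zero, ← inner_sub_left]
    exact e3
  · have hv := d.mem_graph v
    have e1 : ⟪(v : F) - h' (d v), f - a⟫_ℝ = 0 :=
      hb _ (H.comp_eq_zero _ _ (H.homotopy _ _ hv))
    have e2 : ⟪d v, g⟫_ℝ = ⟪h' (d v), f - a⟫_ℝ := by
      rw [← ContinuousLinearMap.adjoint_inner_right, ← sub_eq_zero, ← inner_sub_right,
        ← neg_sub, inner_neg_right, neg_eq_zero]
      exact r.sub_starProjection_mem_orthogonal _ _ (H.apply_mem_graph hv)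
    rw [inner_sub_left, sub_eq_zero] at e1
    rw [hdσ, hdu, real_inner_comm (d v) g, e2, ← e1, real_inner_comm, ← inner_add_right,
      add_sub_cancel, real_inner_comm]

theorem mixedWellPosed (H : ContractsAt d' d h h')
    (hd' : IsClosed (d'.graph : Set (E × F))) (hd : IsClosed (d.graph : Set (F × G)))
    {R : ℝ} (hR : ‖h‖ ≤ R) (hR' : ‖h'‖ ≤ R) :
    MixedWellPosed d' d (3 * R ^ 2 + 3 * R + 1) := by
  refine fun f => ⟨?_, fun σ u hs => H.graphNorm_add_graphNorm_le hR hR' hs⟩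
  obtain ⟨σ, u, hs⟩ := H.exists_isMixedSolution hd' hd f
  refine ⟨(σ, u), hs, fun ⟨σ', u'⟩ hs' => ?_⟩
  -- The difference of two solutions solves the problem with datum `0`.
  have hdiff : IsMixedSolution d' d 0 (σ' - σ) (u' - u) := by
    refine ⟨fun τ => ?_, fun v => ?_⟩
    · have e := hs.1 τ
      have e' := hs'.1 τ
      simp only [Submodule.coe_sub, inner_sub_left, inner_sub_right] at e e' ⊢
      linarith
    · have e := hs.2 v
      have e' := hs'.2 v
      simp only [LinearPMap.map_sub, inner_sub_left, inner_zero_left] at e e' ⊢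
      linarith
  have hb := H.graphNorm_add_graphNorm_le hR hR' hdiff
  rw [norm_zero, mul_zero] at hb
  have b1 := norm_le_graphNorm d (u' - u)
  have b2 := norm_le_graphNorm d' (σ' - σ)
  have c1 := norm_nonneg ((u' - u : d.domain) : F)
  have c2 := norm_nonneg ((σ' - σ : d'.domain) : E)
  refine Prod.ext (sub_eq_zero.1 <| Subtype.ext <| norm_eq_zero.1 ?_)
    (sub_eq_zero.1 <| Subtype.ext <| norm_eq_zero.1 ?_)
  · change ‖((σ' - σ : d'.domain) : E)‖ = 0
    linarith
  · change ‖((u' - u : d.domain) : F)‖ = 0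
    linarith

end ContractsAt

end Contractible

namespace MeridianDomain

variable {Ω : MeridianDomain} {n : ℕ}

/-! ### Closedness of the distributional operators -/

theorem exists_bound (Ω : MeridianDomain) : ∃ R : ℝ, ∀ x ∈ Ω.carrier, ‖x.1‖ ≤ R := by
  obtain ⟨R, hR⟩ := Ω.isBounded.exists_norm_le
  exact ⟨R, fun x hx => (norm_fst_le x).trans (hR x hx)⟩

theorem ae_mem_carrier : ∀ᵐ x ∂Ω.measure, x ∈ Ω.carrier :=
  ae_of_ae_restrict (ae_restrict_mem measurableSet_carrier)

instance isFiniteMeasure_measure : IsFiniteMeasure Ω.measure := by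
  obtain ⟨R, hR⟩ := Ω.exists_bound
  refine isFiniteMeasure_withDensity (ne_of_lt ?_)
  calc ∫⁻ x in Ω.carrier, ENNReal.ofReal x.1 ≤ ∫⁻ _ in Ω.carrier, ENNReal.ofReal R :=
        setLIntegral_mono' measurableSet_carrier fun x hx =>
          ENNReal.ofReal_le_ofReal ((Real.le_norm_self _).trans (hR x hx))
    _ < ⊤ := by
        rw [setLIntegral_const]
        exact ENNReal.mul_lt_top ENNReal.ofReal_lt_top Ω.isBounded.measure_lt_top

theorem Pairable.memLp_divR {ψ : ℝ × ℝ → ℝ} (hψ : Ω.Pairable ψ) :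
    MemLp (divR ψ) 2 Ω.measure := by
  obtain ⟨K, hK, hKΩ, hc, h0⟩ := hψ
  have hc' : ContinuousOn (divR ψ) K :=
    hc.div continuousOn_fst fun x hx => (Ω.pos x (hKΩ hx)).ne'
  have hind : divR ψ = K.indicator (divR ψ) := by
    ext x
    by_cases hx : x ∈ K <;> simp [hx, divR, h0]
  obtain ⟨C, hC⟩ := hK.exists_bound_of_continuousOn hc'
  have hm : AEStronglyMeasurable (divR ψ) Ω.measure := by
    rw [hind, aestronglyMeasurable_indicator_iff hK.measurableSet]
    exact hc'.aestronglyMeasurable hK.measurableSet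
  refine MemLp.of_bound hm (max C 0) (ae_of_all _ fun x => ?_)
  by_cases hx : x ∈ K
  · exact (hC x hx).trans (le_max_left _ _)
  · simp [divR, h0 x hx]

/-- The pairing is the inner product of `L²_r` with `ψ / r`, whence its continuity. -/
theorem pair_eq_inner {ψ : ℝ × ℝ → ℝ} (hψ : Ω.Pairable ψ) (u : Ω.L2) :
    Ω.pair u ψ = ⟪hψ.memLp_divR.toLp _, u⟫_ℝ := by
  have h1 : ⟪hψ.memLp_divR.toLp _, u⟫_ℝ = ∫ x, divR ψ x * u x ∂Ω.measure := by
    rw [L2.inner_def]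
    refine integral_congr_ae ?_
    filter_upwards [hψ.memLp_divR.coeFn_toLp] with x hx
    rw [hx]
    simp [mul_comm]
  have h2 (f : ℝ × ℝ → ℝ) :
      ∫ x, f x ∂Ω.measure = ∫ x in Ω.carrier, (ENNReal.ofReal x.1).toReal • f x :=
    integral_withDensity_eq_integral_toReal_smul (by fun_prop) (by simp) f
  rw [h1, h2, pair]
  refine setIntegral_congr_fun measurableSet_carrier fun x hx => ?_
  have hp := Ω.pos x hx
  simp only [divR, ENNReal.toReal_ofReal hp.le, smul_eq_mul]
  field_simp

theorem Pairable.continuous_pair {ψ : ℝ × ℝ → ℝ} (hψ : Ω.Pairable ψ) :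
    Continuous fun u : Ω.L2 => Ω.pair u ψ := by
  simp only [pair_eq_inner hψ]
  fun_prop

theorem Pairable.continuous_pair_comp {ψ : ℝ × ℝ → ℝ} (hψ : Ω.Pairable ψ) (i : Fin 3) :
    Continuous fun u : Ω.L2Vec => Ω.pair (fun x => u x i) ψ := by
  let A : EuclideanSpace ℝ (Fin 3) →L[ℝ] ℝ := EuclideanSpace.proj i
  let L := A.compLpL 2 Ω.measure
  have : (fun u : Ω.L2Vec => Ω.pair (fun x => u x i) ψ) = fun u => Ω.pair (L u) ψ :=
    funext fun u => pair_congr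
      ((A.coeFn_compLpL (p := 2) (μ := Ω.measure) u).mono fun x hx => hx.symm) ψ
  rw [this]
  exact hψ.continuous_pair.comp L.continuous

theorem isClosed_graph_gradOp : IsClosed ((Ω.gradOp n).graph : Set (Ω.L2 × Ω.L2Vec)) := by
  have : ((Ω.gradOp n).graph : Set (Ω.L2 × Ω.L2Vec)) = {p | Ω.HasGrad n p.1 p.2} :=
    Set.ext fun p => mem_graph_gradOp
  simp only [this, HasGrad, ofPred_forall, ofPred_and]
  refine isClosed_iInter fun φ => isClosed_iInter fun hφ => ?_
  have cr := hφ.pairable_partialR.continuous_pair.comp (continuous_fst (X := Ω.L2) (Y := Ω.L2Vec))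
  have cz := hφ.pairable_partialZ.continuous_pair.comp (continuous_fst (X := Ω.L2) (Y := Ω.L2Vec))
  have cd := hφ.pairable_divR.continuous_pair.comp (continuous_fst (X := Ω.L2) (Y := Ω.L2Vec))
  have c (i) := (hφ.pairable.continuous_pair_comp i).comp
    (continuous_snd (X := Ω.L2) (Y := Ω.L2Vec))
  exact (isClosed_eq (c 0) cr.neg).inter
    ((isClosed_eq (c 1) (continuous_const.mul cd).neg).inter (isClosed_eq (c 2) cz.neg))

theorem isClosed_graph_curlOp : IsClosed ((Ω.curlOp n).graph : Set (Ω.L2Vec × Ω.L2Vec)) := by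
  have : ((Ω.curlOp n).graph : Set (Ω.L2Vec × Ω.L2Vec)) = {p | Ω.HasCurl n p.1 p.2} :=
    Set.ext fun p => mem_graph_curlOp
  simp only [this, HasCurl, ofPred_forall, ofPred_and]
  refine isClosed_iInter fun φ => isClosed_iInter fun hφ => ?_
  have cr (i) := (hφ.pairable_partialR.continuous_pair_comp i).comp
    (continuous_fst (X := Ω.L2Vec) (Y := Ω.L2Vec))
  have cz (i) := (hφ.pairable_partialZ.continuous_pair_comp i).comp
    (continuous_fst (X := Ω.L2Vec) (Y := Ω.L2Vec))
  have cd (i) := (hφ.pairable_divR.continuous_pair_comp i).comp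
    (continuous_fst (X := Ω.L2Vec) (Y := Ω.L2Vec))
  have c (i) := (hφ.pairable.continuous_pair_comp i).comp
    (continuous_snd (X := Ω.L2Vec) (Y := Ω.L2Vec))
  exact (isClosed_eq (c 0) ((continuous_const.mul (cd 2)).sub (cz 1)).neg).inter
    ((isClosed_eq (c 1) ((cz 0).neg.add (cr 2))).inter
      (isClosed_eq (c 2) (((continuous_const.mul (cd 0)).add (cd 1)).sub (cr 1))))

theorem isClosed_graph_divOp : IsClosed ((Ω.divOp n).graph : Set (Ω.L2Vec × Ω.L2)) := by
  have : ((Ω.divOp n).graph : Set (Ω.L2Vec × Ω.L2)) = {p | Ω.HasDiv n p.1 p.2} :=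
    Set.ext fun p => mem_graph_divOp
  simp only [this, HasDiv, ofPred_forall]
  refine isClosed_iInter fun φ => isClosed_iInter fun hφ => ?_
  have cr := (hφ.pairable_partialR.continuous_pair_comp 0).comp
    (continuous_fst (X := Ω.L2Vec) (Y := Ω.L2))
  have cz := (hφ.pairable_partialZ.continuous_pair_comp 2).comp
    (continuous_fst (X := Ω.L2Vec) (Y := Ω.L2))
  have cd (i) := (hφ.pairable_divR.continuous_pair_comp i).comp
    (continuous_fst (X := Ω.L2Vec) (Y := Ω.L2))
  have c := hφ.pairable.continuous_pair.comp (continuous_snd (X := Ω.L2Vec) (Y := Ω.L2))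
  exact isClosed_eq c
    ((cr.neg.add ((cd 0).sub (continuous_const.mul (cd 1)))).sub cz)

theorem isClosed_graph_zero {E F : Type*} [NormedAddCommGroup E] [InnerProductSpace ℝ E]
    [NormedAddCommGroup F] [InnerProductSpace ℝ F] :
    IsClosed ((0 : E →ₗ.[ℝ] F).graph : Set (E × F)) := by
  have : ((0 : E →ₗ.[ℝ] F).graph : Set (E × F)) = {p | p.2 = 0} := by
    ext ⟨x, y⟩
    simp [LinearPMap.mem_graph_iff, eq_comm]
  rw [this]
  exact isClosed_eq continuous_snd continuous_const

/-! ### Calculus of test functions -/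

/-- The function `r φ`. -/
def mulR (φ : ℝ × ℝ → ℝ) (x : ℝ × ℝ) : ℝ := x.1 * φ x

theorem IsTest.partial {φ : ℝ × ℝ → ℝ} (h : Ω.IsTest φ) (e : ℝ × ℝ) :
    Ω.IsTest fun x => fderiv ℝ φ x e := by
  have hs : tsupport (fun x => fderiv ℝ φ x e) ⊆ tsupport φ :=
    closure_minimal (fun x hx => by
      by_contra h'
      refine hx ?_
      beta_reduce
      rw [image_eq_zero_of_notMem_tsupport fun h'' => h' (tsupport_fderiv_subset ℝ h'')]
      rfl) (isClosed_tsupport φ)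
  exact ⟨(h.1.fderiv_right (by simp)).clm_apply contDiff_const,
    h.2.1.of_isClosed_subset (isClosed_tsupport _) hs, hs.trans h.2.2⟩

theorem IsTest.partialR {φ : ℝ × ℝ → ℝ} (h : Ω.IsTest φ) : Ω.IsTest (partialR φ) := h.partial _

theorem IsTest.partialZ {φ : ℝ × ℝ → ℝ} (h : Ω.IsTest φ) : Ω.IsTest (partialZ φ) := h.partial _

theorem IsTest.mulR {φ : ℝ × ℝ → ℝ} (h : Ω.IsTest φ) : Ω.IsTest (mulR φ) :=
  ⟨contDiff_fst.mul h.1, h.2.1.mul_left, (tsupport_mul_subset_right (f := Prod.fst)).trans h.2.2⟩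

theorem IsTest.divR {φ : ℝ × ℝ → ℝ} (h : Ω.IsTest φ) : Ω.IsTest (divR φ) := by
  have hs : tsupport (_root_.divR φ) ⊆ tsupport φ :=
    closure_mono fun x hx hx' => hx (by simp [_root_.divR, hx'])
  refine ⟨contDiff_iff_contDiffAt.2 fun x => ?_,
    h.2.1.of_isClosed_subset (isClosed_tsupport _) hs, hs.trans h.2.2⟩
  by_cases hx : x ∈ tsupport φ
  · exact h.1.contDiffAt.div contDiffAt_fst (Ω.pos x (h.2.2 hx)).ne'
  · refine (contDiffAt_const (c := (0 : ℝ))).congr_of_eventuallyEq ?_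
    filter_upwards [notMem_tsupport_iff_eventuallyEq.1 hx] with y hy
    simp [_root_.divR, hy]

theorem IsTest.partialZ_partialR {φ : ℝ × ℝ → ℝ} (h : Ω.IsTest φ) :
    _root_.partialZ (_root_.partialR φ) = _root_.partialR (_root_.partialZ φ) := by
  ext x
  have hd : DifferentiableAt ℝ (fderiv ℝ φ) x :=
    ((h.1.fderiv_right (m := ∞) (by simp)).differentiable (by simp)).differentiableAt
  have key (e e' : ℝ × ℝ) :
      fderiv ℝ (fun y => fderiv ℝ φ y e) x e' = fderiv ℝ (fderiv ℝ φ) x e' e := by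
    rw [fderiv_clm_apply hd (differentiableAt_const e)]
    simp
  change fderiv ℝ (fun y => fderiv ℝ φ y (1, 0)) x (0, 1)
    = fderiv ℝ (fun y => fderiv ℝ φ y (0, 1)) x (1, 0)
  rw [key, key]
  refine (h.1.contDiffAt (x := x)).isSymmSndFDerivAt ?_ _ _
  simpa using WithTop.coe_le_coe.2 (le_top : (2 : ℕ∞) ≤ ⊤)

theorem IsTest.hasFDerivAt {φ : ℝ × ℝ → ℝ} (h : Ω.IsTest φ) (x : ℝ × ℝ) :
    HasFDerivAt φ (fderiv ℝ φ x) x :=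
  (h.1.differentiable (by simp)).differentiableAt.hasFDerivAt

theorem IsTest.fderiv_mulR {φ : ℝ × ℝ → ℝ} (h : Ω.IsTest φ) (x e : ℝ × ℝ) :
    fderiv ℝ (MeridianDomain.mulR φ) x e = x.1 * fderiv ℝ φ x e + φ x * e.1 := by
  have := (hasFDerivAt_fst (𝕜 := ℝ) (p := x)).mul (h.hasFDerivAt x)
  rw [show MeridianDomain.mulR φ = Prod.fst * φ from rfl, this.fderiv]
  simp

theorem IsTest.partialR_mulR {φ : ℝ × ℝ → ℝ} (h : Ω.IsTest φ) :
    _root_.partialR (MeridianDomain.mulR φ)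
      = fun x => φ x + MeridianDomain.mulR (_root_.partialR φ) x := by
  ext x
  simp only [_root_.partialR, MeridianDomain.mulR, h.fderiv_mulR]
  ring

theorem IsTest.partialZ_mulR {φ : ℝ × ℝ → ℝ} (h : Ω.IsTest φ) :
    _root_.partialZ (MeridianDomain.mulR φ) = MeridianDomain.mulR (_root_.partialZ φ) := by
  ext x
  simp only [_root_.partialZ, MeridianDomain.mulR, h.fderiv_mulR]
  ring

theorem mulR_divR (φ : ℝ × ℝ → ℝ) {x : ℝ × ℝ} (hx : x ∈ Ω.carrier) :
    mulR (divR φ) x = φ x :=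
  mul_div_cancel₀ _ (Ω.pos x hx).ne'

theorem divR_mulR (φ : ℝ × ℝ → ℝ) {x : ℝ × ℝ} (hx : x ∈ Ω.carrier) :
    divR (mulR φ) x = φ x :=
  mul_div_cancel_left₀ _ (Ω.pos x hx).ne'

/-- The product rule, read off from `φ = r (φ / r)` near `Ω`. -/
theorem IsTest.fderiv_divR {φ : ℝ × ℝ → ℝ} (h : Ω.IsTest φ) {x : ℝ × ℝ} (hx : x ∈ Ω.carrier)
    (e : ℝ × ℝ) :
    fderiv ℝ φ x e = x.1 * fderiv ℝ (_root_.divR φ) x e + _root_.divR φ x * e.1 := by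
  rw [← h.divR.fderiv_mulR]
  have : φ =ᶠ[nhds x] MeridianDomain.mulR (_root_.divR φ) := by
    filter_upwards [Ω.isOpen.mem_nhds hx] with y hy
    exact (mulR_divR φ hy).symm
  rw [this.fderiv_eq]

theorem IsTest.partialR_divR {φ : ℝ × ℝ → ℝ} (h : Ω.IsTest φ) {x : ℝ × ℝ}
    (hx : x ∈ Ω.carrier) :
    _root_.divR (_root_.partialR φ) x
      = _root_.partialR (_root_.divR φ) x + _root_.divR (_root_.divR φ) x := by
  have hp := (Ω.pos x hx).ne'
  rw [_root_.divR, _root_.partialR, h.fderiv_divR hx, _root_.partialR,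
    _root_.divR.eq_1 (_root_.divR φ)]
  field_simp

theorem IsTest.partialZ_divR {φ : ℝ × ℝ → ℝ} (h : Ω.IsTest φ) {x : ℝ × ℝ}
    (hx : x ∈ Ω.carrier) :
    _root_.divR (_root_.partialZ φ) x = _root_.partialZ (_root_.divR φ) x := by
  have hp := (Ω.pos x hx).ne'
  rw [_root_.divR, _root_.partialZ, h.fderiv_divR hx, _root_.partialZ]
  field_simp
  simp

theorem pair_congr_right (f : ℝ × ℝ → ℝ) {ψ ψ' : ℝ × ℝ → ℝ}
    (h : ∀ x ∈ Ω.carrier, ψ x = ψ' x) : Ω.pair f ψ = Ω.pair f ψ' :=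
  setIntegral_congr_fun measurableSet_carrier fun x hx => by simp only [h x hx]

theorem pair_add_right {f ψ ψ' : ℝ × ℝ → ℝ} (hf : MemLp f 2 Ω.measure) (hψ : Ω.Pairable ψ)
    (hψ' : Ω.Pairable ψ') : Ω.pair f (fun x => ψ x + ψ' x) = Ω.pair f ψ + Ω.pair f ψ' := by
  rw [pair, pair, pair, ← integral_add (hψ.integrableOn hf) (hψ'.integrableOn hf)]
  simp only [mul_add]

theorem pair_divR_mulR (f φ : ℝ × ℝ → ℝ) : Ω.pair f (divR (mulR φ)) = Ω.pair f φ :=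
  pair_congr_right f fun _ hx => divR_mulR φ hx

theorem IsTest.pair_partialR_mulR {φ f : ℝ × ℝ → ℝ} (h : Ω.IsTest φ) (hf : MemLp f 2 Ω.measure) :
    Ω.pair f (_root_.partialR (MeridianDomain.mulR φ))
      = Ω.pair f φ + Ω.pair f (MeridianDomain.mulR (_root_.partialR φ)) := by
  rw [h.partialR_mulR, pair_add_right hf h.pairable h.partialR.mulR.pairable]

theorem IsTest.pair_divR_partialR {φ f : ℝ × ℝ → ℝ} (h : Ω.IsTest φ) (hf : MemLp f 2 Ω.measure) :
    Ω.pair f (_root_.divR (_root_.partialR φ))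
      = Ω.pair f (_root_.partialR (_root_.divR φ))
        + Ω.pair f (_root_.divR (_root_.divR φ)) := by
  rw [← pair_add_right hf h.divR.partialR.pairable h.divR.divR.pairable]
  exact pair_congr_right f fun _ hx => h.partialR_divR hx

theorem IsTest.pair_divR_partialZ {φ : ℝ × ℝ → ℝ} (h : Ω.IsTest φ) (f : ℝ × ℝ → ℝ) :
    Ω.pair f (_root_.divR (_root_.partialZ φ))
      = Ω.pair f (_root_.partialZ (_root_.divR φ)) :=
  pair_congr_right f fun _ hx => h.partialZ_divR hx

/-! ### The complex property -/

/-- `d¹ ∘ d⁰ = 0`: test the components of `g` with derivatives and quotients of test functions. -/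
theorem HasGrad.hasCurl {u : Ω.L2} {g : Ω.L2Vec} (h : Ω.HasGrad n u g) : Ω.HasCurl n g 0 := by
  intro φ hφ
  obtain ⟨d0, d1, d2⟩ := h _ hφ.divR
  obtain ⟨-, r1, r2⟩ := h _ hφ.partialR
  obtain ⟨z0, z1, -⟩ := h _ hφ.partialZ
  have e1 := hφ.pair_divR_partialR (Lp.memLp u)
  have e2 := hφ.pair_divR_partialZ u
  have e3 := hφ.partialZ_partialR
  simp only [pair_comp_zero]
  refine ⟨?_, ?_, ?_⟩
  · rw [d2, z1, e2]; ring
  · rw [z0, r2, e3]; ring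
  · rw [d0, d1, r1, e1]; ring

/-- `d² ∘ d¹ = 0`, by the same choice of test functions. -/
theorem HasCurl.hasDiv {u g : Ω.L2Vec} (h : Ω.HasCurl n u g) : Ω.HasDiv n g 0 := by
  intro φ hφ
  obtain ⟨d0, d1, d2⟩ := h _ hφ.divR
  obtain ⟨r0, -, -⟩ := h _ hφ.partialR
  obtain ⟨-, -, z2⟩ := h _ hφ.partialZ
  have e1 (i : Fin 3) := hφ.pair_divR_partialR (memLp_comp u i)
  have e2 (i : Fin 3) := hφ.pair_divR_partialZ fun x => u x i
  have e3 := hφ.partialZ_partialR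
  rw [pair_coe_zero, r0, d0, d1, z2, e1, e2, e2, e3]
  ring

/-! ### The contracting homotopy -/

variable (Ω) in
/-- The coordinate `r` as an essentially bounded function. -/
noncomputable def radius : Lp ℝ ∞ Ω.measure :=
  MemLp.toLp Prod.fst <| by
    obtain ⟨R, hR⟩ := Ω.exists_bound
    exact memLp_top_of_bound (by fun_prop) R (ae_mem_carrier.mono hR)

variable {V W : Type*} [NormedAddCommGroup V] [NormedSpace ℝ V] [NormedAddCommGroup W]
  [NormedSpace ℝ W]

variable (Ω) in
/-- The operator `f ↦ r A f`, for a constant linear map `A` between the spaces of values. -/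
noncomputable def radialMul (A : V →L[ℝ] W) : Lp V 2 Ω.measure →L[ℝ] Lp W 2 Ω.measure :=
  (ContinuousLinearMap.toSpanSingleton ℝ A).holderL Ω.measure ∞ 2 2 Ω.radius

theorem coeFn_radialMul (A : V →L[ℝ] W) (f : Lp V 2 Ω.measure) :
    Ω.radialMul A f =ᵐ[Ω.measure] fun x => x.1 • A (f x) := by
  have h1 := (ContinuousLinearMap.toSpanSingleton ℝ A).coeFn_holder (r := 2) Ω.radius f
  have h2 : Ω.radius =ᵐ[Ω.measure] Prod.fst := MemLp.coeFn_toLp _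
  filter_upwards [h1, h2] with x hx hx'
  rw [hx'] at hx
  exact hx

/-- The contraction of one-forms with `∂_θ`, up to the factor `1/n`: `u ↦ -r u_θ`. -/
noncomputable def contractOne (Ω : MeridianDomain) : Ω.L2Vec →L[ℝ] Ω.L2 :=
  Ω.radialMul (-EuclideanSpace.proj 1)

/-- The contraction of two-forms with `∂_θ`, up to the factor `1/n`: `w ↦ (r w_z, 0, -r w_r)`. -/
noncomputable def contractTwo (Ω : MeridianDomain) : Ω.L2Vec →L[ℝ] Ω.L2Vec :=
  Ω.radialMul ((EuclideanSpace.proj 2).smulRight (EuclideanSpace.single 0 (1 : ℝ))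
    - (EuclideanSpace.proj 0).smulRight (EuclideanSpace.single 2 (1 : ℝ)))

/-- The contraction of three-forms with `∂_θ`, up to the factor `1/n`: `w ↦ (0, -r w, 0)`. -/
noncomputable def contractThree (Ω : MeridianDomain) : Ω.L2 →L[ℝ] Ω.L2Vec :=
  Ω.radialMul (-ContinuousLinearMap.toSpanSingleton ℝ (EuclideanSpace.single 1 (1 : ℝ)))

theorem pair_mul_fst (c : ℝ) (f ψ : ℝ × ℝ → ℝ) :
    Ω.pair (fun x => x.1 * (c * f x)) ψ = c * Ω.pair f (mulR ψ) := by
  rw [← pair_smul]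
  exact integral_congr_ae (ae_of_all _ fun x => by simp only [mulR]; ring)

theorem pair_contractOne (u : Ω.L2Vec) (ψ : ℝ × ℝ → ℝ) :
    Ω.pair (Ω.contractOne u) ψ = -Ω.pair (fun x => u x 1) (mulR ψ) := by
  rw [← neg_one_mul, ← pair_mul_fst]
  exact pair_congr ((coeFn_radialMul _ u).mono fun x hx => by
    rw [contractOne, hx]; simp) ψ

theorem pair_contractTwo_zero (u : Ω.L2Vec) (ψ : ℝ × ℝ → ℝ) :
    Ω.pair (fun x => Ω.contractTwo u x 0) ψ = Ω.pair (fun x => u x 2) (mulR ψ) := by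
  rw [← one_mul (Ω.pair _ (mulR ψ)), ← pair_mul_fst]
  exact pair_congr ((coeFn_radialMul _ u).mono fun x hx => by
    dsimp only [contractTwo]; rw [hx]; simp) ψ

theorem pair_contractTwo_one (u : Ω.L2Vec) (ψ : ℝ × ℝ → ℝ) :
    Ω.pair (fun x => Ω.contractTwo u x 1) ψ = 0 := by
  rw [← zero_mul (Ω.pair 0 (mulR ψ)), ← pair_mul_fst]
  exact pair_congr ((coeFn_radialMul _ u).mono fun x hx => by
    dsimp only [contractTwo]; rw [hx]; simp) ψ

theorem pair_contractTwo_two (u : Ω.L2Vec) (ψ : ℝ × ℝ → ℝ) :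
    Ω.pair (fun x => Ω.contractTwo u x 2) ψ = -Ω.pair (fun x => u x 0) (mulR ψ) := by
  rw [← neg_one_mul, ← pair_mul_fst]
  exact pair_congr ((coeFn_radialMul _ u).mono fun x hx => by
    dsimp only [contractTwo]; rw [hx]; simp) ψ

theorem pair_contractThree_one (w : Ω.L2) (ψ : ℝ × ℝ → ℝ) :
    Ω.pair (fun x => Ω.contractThree w x 1) ψ = -Ω.pair w (mulR ψ) := by
  rw [← neg_one_mul, ← pair_mul_fst]
  exact pair_congr ((coeFn_radialMul _ w).mono fun x hx => by
    dsimp only [contractThree]; rw [hx]; simp) ψ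

theorem pair_contractThree_of_ne (w : Ω.L2) (ψ : ℝ × ℝ → ℝ) {i : Fin 3} (hi : i ≠ 1) :
    Ω.pair (fun x => Ω.contractThree w x i) ψ = 0 := by
  rw [← zero_mul (Ω.pair 0 (mulR ψ)), ← pair_mul_fst]
  exact pair_congr ((coeFn_radialMul _ w).mono fun x hx => by
    dsimp only [contractThree]; rw [hx]; simp [hi]) ψ

theorem pair_coe_sub_smul {ψ : ℝ × ℝ → ℝ} (hψ : Ω.Pairable ψ) (c : ℝ) (u v : Ω.L2) :
    Ω.pair (u - c • v : Ω.L2) ψ = Ω.pair u ψ - c * Ω.pair v ψ := by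
  rw [sub_eq_add_neg, ← neg_smul, pair_coe_add hψ, pair_coe_smul]
  ring

theorem pair_comp_sub_smul {ψ : ℝ × ℝ → ℝ} (hψ : Ω.Pairable ψ) (c : ℝ) (u v : Ω.L2Vec)
    (i : Fin 3) :
    Ω.pair (fun x => (u - c • v : Ω.L2Vec) x i) ψ
      = Ω.pair (fun x => u x i) ψ - c * Ω.pair (fun x => v x i) ψ := by
  rw [sub_eq_add_neg, ← neg_smul, pair_comp_add hψ, pair_comp_smul]
  ring

/-- `h¹ d⁰ u = u`. This and the next two lemmas use the definition of `dᵏ u` with the test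
function `r φ`, because the homotopy moves its factor `r` onto `φ`. -/
theorem HasGrad.contractOne_eq (hn : n ≠ 0) {u : Ω.L2} {g : Ω.L2Vec} (h : Ω.HasGrad n u g) :
    u - (n : ℝ)⁻¹ • Ω.contractOne g = 0 := by
  have hn : (n : ℝ) ≠ 0 := Nat.cast_ne_zero.2 hn
  refine eq_zero_of_pair fun φ hφ => ?_
  obtain ⟨-, e, -⟩ := h _ hφ.mulR
  rw [pair_coe_sub_smul hφ.pairable, pair_contractOne, e, pair_divR_mulR]
  field_simp
  ring

/-- `d⁰ h¹ u = u - h² d¹ u`. -/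
theorem HasCurl.hasGrad_contractOne (hn : n ≠ 0) {u g : Ω.L2Vec} (h : Ω.HasCurl n u g) :
    Ω.HasGrad n ((n : ℝ)⁻¹ • Ω.contractOne u) (u - (n : ℝ)⁻¹ • Ω.contractTwo g) := by
  have hn : (n : ℝ) ≠ 0 := Nat.cast_ne_zero.2 hn
  intro φ hφ
  obtain ⟨e0, -, e2⟩ := h _ hφ.mulR
  have hr := hφ.pair_partialR_mulR (memLp_comp u 1)
  simp only [pair_divR_mulR, hφ.partialZ_mulR] at e0 e2
  have hm : Ω.pair (fun x => u x 1) (mulR (divR φ)) = Ω.pair (fun x => u x 1) φ :=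
    pair_congr_right _ fun _ hx => mulR_divR φ hx
  simp only [pair_comp_sub_smul hφ.pairable, pair_coe_smul, pair_contractOne,
    pair_contractTwo_zero, pair_contractTwo_one, pair_contractTwo_two, e0, e2, hr, hm]
  refine ⟨?_, ?_, ?_⟩ <;> field_simp <;> ring

/-- `d¹ h² w = w - h³ d² w`. -/
theorem HasDiv.hasCurl_contractTwo (hn : n ≠ 0) {w : Ω.L2Vec} {g : Ω.L2} (h : Ω.HasDiv n w g) :
    Ω.HasCurl n ((n : ℝ)⁻¹ • Ω.contractTwo w) (w - (n : ℝ)⁻¹ • Ω.contractThree g) := by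
  have hn : (n : ℝ) ≠ 0 := Nat.cast_ne_zero.2 hn
  intro φ hφ
  have e := h _ hφ.mulR
  have hr := hφ.pair_partialR_mulR (memLp_comp w 0)
  simp only [pair_divR_mulR, hφ.partialZ_mulR] at e
  have hm (i : Fin 3) : Ω.pair (fun x => w x i) (mulR (divR φ)) = Ω.pair (fun x => w x i) φ :=
    pair_congr_right _ fun _ hx => mulR_divR φ hx
  have h0 := pair_contractThree_of_ne g φ (i := 0) (by decide)
  have h2 := pair_contractThree_of_ne g φ (i := 2) (by decide)
  simp only [pair_comp_sub_smul hφ.pairable, pair_comp_smul,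
    pair_contractTwo_zero, pair_contractTwo_one, pair_contractTwo_two, pair_contractThree_one,
    h0, h2, e, hr, hm]
  refine ⟨?_, ?_, ?_⟩ <;> field_simp <;> ring

/-- `d² h³ w = w`. -/
theorem hasDiv_contractThree (hn : n ≠ 0) (w : Ω.L2) :
    Ω.HasDiv n ((n : ℝ)⁻¹ • Ω.contractThree w) w := by
  have hn : (n : ℝ) ≠ 0 := Nat.cast_ne_zero.2 hn
  intro φ hφ
  have hm : Ω.pair w (mulR (divR φ)) = Ω.pair w φ :=
    pair_congr_right _ fun _ hx => mulR_divR φ hx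
  have h0 (ψ) := pair_contractThree_of_ne w ψ (i := 0) (by decide)
  have h2 (ψ) := pair_contractThree_of_ne w ψ (i := 2) (by decide)
  simp only [pair_comp_smul, pair_contractThree_one, h0, h2, hm]
  field_simp
  ring

/-! ### Well-posedness with a constant independent of the mode -/

theorem contractsAt_zero (hn : n ≠ 0) :
    ContractsAt Ω.initOp (Ω.gradOp n) 0 ((n : ℝ)⁻¹ • Ω.contractOne) where
  comp_eq_zero x y hxy := by
    obtain ⟨_, _, rfl⟩ := (LinearPMap.mem_graph_iff _).1 hxy
    exact (Ω.gradOp n).graph.zero_mem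
  homotopy u g hu := by
    have := (mem_graph_gradOp.1 hu).contractOne_eq hn
    simp only [smul_apply, this]
    exact Ω.initOp.graph.zero_mem

theorem contractsAt_one (hn : n ≠ 0) :
    ContractsAt (Ω.gradOp n) (Ω.curlOp n) ((n : ℝ)⁻¹ • Ω.contractOne)
      ((n : ℝ)⁻¹ • Ω.contractTwo) where
  comp_eq_zero _ _ h := mem_graph_curlOp.2 (mem_graph_gradOp.1 h).hasCurl
  homotopy _ _ h := mem_graph_gradOp.2 ((mem_graph_curlOp.1 h).hasGrad_contractOne hn)

theorem contractsAt_two (hn : n ≠ 0) :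
    ContractsAt (Ω.curlOp n) (Ω.divOp n) ((n : ℝ)⁻¹ • Ω.contractTwo)
      ((n : ℝ)⁻¹ • Ω.contractThree) where
  comp_eq_zero _ _ h := mem_graph_divOp.2 (mem_graph_curlOp.1 h).hasDiv
  homotopy _ _ h := mem_graph_curlOp.2 ((mem_graph_divOp.1 h).hasCurl_contractTwo hn)

theorem contractsAt_three (hn : n ≠ 0) :
    ContractsAt (Ω.divOp n) Ω.lastOp ((n : ℝ)⁻¹ • Ω.contractThree) 0 where
  comp_eq_zero _ y _ := (LinearPMap.mem_graph_iff _).2 ⟨⟨y, trivial⟩, rfl, rfl⟩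
  homotopy u g _ := by
    simpa using mem_graph_divOp.2 (hasDiv_contractThree hn u)

theorem norm_inv_smul_le (hn : n ≠ 0) {X : Type*} [SeminormedAddCommGroup X] [NormedSpace ℝ X]
    (T : X) : ‖(n : ℝ)⁻¹ • T‖ ≤ ‖T‖ := by
  rw [norm_smul, norm_inv, Real.norm_natCast]
  exact mul_le_of_le_one_left (norm_nonneg _)
    (inv_le_one_of_one_le₀ (Nat.one_le_cast.2 (Nat.one_le_iff_ne_zero.2 hn)))

end MeridianDomain

open MeridianDomain in
theorem theorem3p1 (Ω : MeridianDomain) :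
    ∃ C : ℝ, 0 < C ∧ ∀ n : ℕ, 0 < n →
      -- `k = 0`
      MixedWellPosed Ω.initOp (Ω.gradOp n) C ∧
      -- `k = 1`
      MixedWellPosed (Ω.gradOp n) (Ω.curlOp n) C ∧
      -- `k = 2`
      MixedWellPosed (Ω.curlOp n) (Ω.divOp n) C ∧
      -- `k = 3`
      MixedWellPosed (Ω.divOp n) Ω.lastOp C := by
  set R := ‖Ω.contractOne‖ + ‖Ω.contractTwo‖ + ‖Ω.contractThree‖ with hR
  have p1 := norm_nonneg Ω.contractOne
  have p2 := norm_nonneg Ω.contractTwo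
  have p3 := norm_nonneg Ω.contractThree
  have hR0 : 0 ≤ R := by positivity
  refine ⟨3 * R ^ 2 + 3 * R + 1, by positivity, fun n hn => ?_⟩
  have b1 : ‖(n : ℝ)⁻¹ • Ω.contractOne‖ ≤ R :=
    (norm_inv_smul_le hn.ne' Ω.contractOne).trans (by linarith)
  have b2 : ‖(n : ℝ)⁻¹ • Ω.contractTwo‖ ≤ R :=
    (norm_inv_smul_le hn.ne' Ω.contractTwo).trans (by linarith)
  have b3 : ‖(n : ℝ)⁻¹ • Ω.contractThree‖ ≤ R :=
    (norm_inv_smul_le hn.ne' Ω.contractThree).trans (by linarith)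
  exact ⟨(contractsAt_zero hn.ne').mixedWellPosed isClosed_graph_zero isClosed_graph_gradOp
      (by simpa using hR0) b1,
    (contractsAt_one hn.ne').mixedWellPosed isClosed_graph_gradOp isClosed_graph_curlOp b1 b2,
    (contractsAt_two hn.ne').mixedWellPosed isClosed_graph_curlOp isClosed_graph_divOp b2 b3,
    (contractsAt_three hn.ne').mixedWellPosed isClosed_graph_divOp isClosed_graph_zero b3
      (by simpa using hR0)⟩
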